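/- All graphs are finite and simple. Let $G=(V,E)$ be a graph, $n=|V|$, and $k\ge 1$. A $k$-cover $H$ of $G$ consists of a list $L(v)$ of exactly $k$ colors for each vertex $v$ (from an arbitrary color set $\Gamma$) and, for each edge $uv\in E$, a (possibly empty, not necessarily perfect) matching $M(uv)$ between $\{u\}\times L(u)$ and $\{v\}\times L(v)$. An $H$-coloring is a map $f:V\to\Gamma$ with $f(v)\in L(v)$ for every $v\in V$ such that for every edge $uv\in E$ the pairs $(u,f(u))$ and $(v,f(v))$ are not matched by $M(uv)$. It is strongly $\lceil n/k\rceil$-bounded if every color class $f^{-1}(\alpha)$, $\alpha\in\Gamma$, has at most $\lceil n/k\rceil$ vertices and at most $n \bmod k$ color classes have exactly $\lfloor n/k\rfloor+1$ vertices. The graph $G$ is strongly equitably DP $k$-colorable if for every $k$-cover $H$ of $G$ there is a strongly $\lceil n/k\rceil$-bounded $H$-coloring. A star is a graph $K_{1,m}$ with $m\ge 0$. Theorem. Every finite forest $G$ is a star or is strongly equitably DP $k$-colorable for all $k\ge\max\{\Delta(G),4\}$, where $\Delta(G)$ is the maximum degree of $G$. -/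

import Mathlib

universe u w

namespace EquitableDP

/-- A cover of the graph `G` with colors from `Γ`, all of whose lists are finite: a list assignment
`list` together with a graph `graph` on the nodes `(v, α)`, in which every edge joins a color of
`list u` to a color of `list v` for some edge `uv` of `G`, and in which the edges over each edge
`uv` of `G` form a (possibly empty, not necessarily perfect) matching. -/
structure Cover {V : Type u} (G : SimpleGraph V) (Γ : Type w) where
  /-- The list assignment. -/
  list : V → Finset Γ
  /-- The cover graph. Pairs `(v, α)` with `α ∉ list v` are not nodes of the cover; they are
  isolated vertices of this graph. -/
  graph : SimpleGraph (V × Γ)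
  mem_list : ∀ {u v : V} {α β : Γ}, graph.Adj (u, α) (v, β) → α ∈ list u ∧ β ∈ list v
  adj_base : ∀ {u v : V} {α β : Γ}, graph.Adj (u, α) (v, β) → G.Adj u v
  /-- A node has at most one neighbor over each vertex of `G`. As `graph` is symmetric, this says
  exactly that the edges over each edge of `G` form a matching. -/
  matching : ∀ {u v : V} {α β β' : Γ},
    graph.Adj (u, α) (v, β) → graph.Adj (u, α) (v, β') → β = β'

variable {V : Type u} {Γ : Type w}

/-- `H` is a `k`-cover: every list has exactly `k` colors. -/
def Cover.IsKCover {G : SimpleGraph V} (H : Cover G Γ) (k : ℕ) : Prop :=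
  ∀ v, (H.list v).card = k

/-- `f` is an `H`-coloring: it picks a color from each list, and the picked nodes are independent
in the cover graph. -/
def Cover.IsColoring {G : SimpleGraph V} (H : Cover G Γ) (f : V → Γ) : Prop :=
  (∀ v, f v ∈ H.list v) ∧ H.graph.IsIndepSet (Set.range fun v => (v, f v))

/-- The number of vertices in the color class of `α`. -/
noncomputable def classSize (f : V → Γ) (α : Γ) : ℕ := (f ⁻¹' {α}).ncard

/-- `f` is `m`-bounded for `m = ⌈|V| / k⌉`. -/
def IsBounded (f : V → Γ) (k : ℕ) : Prop :=
  ∀ α, classSize f α ≤ Nat.card V ⌈/⌉ k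

/-- `f` is strongly `m`-bounded for `m = ⌈|V| / k⌉`: it is `m`-bounded, and at most `|V| mod k`
color classes are large, i.e. have size exactly `⌊|V| / k⌋ + 1`. -/
def IsStronglyBounded (f : V → Γ) (k : ℕ) : Prop :=
  IsBounded f k ∧
    {α | classSize f α = Nat.card V / k + 1}.encard ≤ (Nat.card V % k : ℕ)

/-- `G` is strongly equitably DP `k`-colorable: for every color set, every `k`-cover `H` of `G`
admits a strongly `⌈|G| / k⌉`-bounded `H`-coloring. -/
def IsSEDPColorable (G : SimpleGraph V) (k : ℕ) : Prop :=
  ∀ (Γ : Type w) (H : Cover G Γ), H.IsKCover k →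
    ∃ f : V → Γ, H.IsColoring f ∧ IsStronglyBounded f k

/-- `G` is a star `K_{1,m}`, `m ≥ 0`: some center is joined to all other vertices, and there are no
further edges. -/
def IsStar (G : SimpleGraph V) : Prop := ∃ r : V, G = SimpleGraph.starGraph r

end EquitableDP

namespace EquitableDP

open Finset

/-! Induction on vertex sets `U`. A block `S` of `k` vertices is split off, the rest `R` is colored
inductively, and `S` receives pairwise distinct colors. The floor of `|U| / k` then grows by one,
the remainder stays, and each class grows by at most one, so strong boundedness survives
(`StronglyBoundedOn.union`).

The block consists of a vertex `x` with no neighbor other than `y`, the vertex `y`, a vertex `z` not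
adjacent to `y`, and `k - 3` vertices with at most one earlier neighbor each, which are colored
greedily. The last vertex `x` must avoid the `k - 1` colors of the block and the color matched to
that of `y`, possibly its whole list. Therefore `y` and `z` are colored jointly so that their two
colors and the matched one exclude at most two colors at `x` (`Cover.exists_slack`,
`Cover.ColorableOn.of_block`).

The block must not leave a star on `k` or more vertices. If it leaves one with center `c`, then
either `z` can be traded for a leaf of that star, or `c` has degree `k` and `|U| = 2k`, and a new
block is built with `c` in the role of `y` (`Cover.colorableOn`). For `|U| < k` greedy coloring
suffices; for `|U| = k` all colors must differ (`Cover.colorableOn_of_card_eq`), and the path on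
four vertices needs its own count (`exists_distinct_colors`). -/

open scoped Classical in
/-- The number of neighbors of `v` in `U`. -/
noncomputable def degOn {V : Type u} (G : SimpleGraph V) (U : Finset V) (v : V) : ℕ :=
  (U.filter (G.Adj v)).card

/-- `c` is adjacent to all other vertices of `U`. -/
def StarAt {V : Type u} (G : SimpleGraph V) (U : Finset V) (c : V) : Prop :=
  ∀ v ∈ U, v ≠ c → G.Adj c v

/-! ### Leaves of forests and pruning. -/

section Forest

variable {V : Type u} {G : SimpleGraph V}

theorem degOn_mono {A B : Finset V} (h : A ⊆ B) (v : V) : degOn G A v ≤ degOn G B v := by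
  classical
  exact card_le_card (filter_subset_filter _ h)

theorem degOn_le_card (A : Finset V) (v : V) : degOn G A v ≤ A.card := by
  classical
  exact card_le_card (filter_subset _ _)

theorem degOn_le_one_iff {A : Finset V} {v : V} :
    degOn G A v ≤ 1 ↔ ∀ a ∈ A, ∀ b ∈ A, G.Adj v a → G.Adj v b → a = b := by
  classical
  unfold degOn
  rw [card_le_one]
  simp only [mem_filter, and_imp]
  exact ⟨fun h a ha b hb h1 h2 => h a ha h1 b hb h2, fun h a ha h1 b hb h2 => h a ha b hb h1 h2⟩

theorem degOn_erase_of_adj [DecidableEq V] {A : Finset V} {v a : V} (ha : a ∈ A)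
    (h : G.Adj v a) : degOn G (A.erase a) v + 1 = degOn G A v := by
  classical
  unfold degOn
  rw [filter_erase, card_erase_add_one]
  simp [ha, h]

theorem degOn_erase_of_not_adj [DecidableEq V] {A : Finset V} {v a : V}
    (h : ¬ G.Adj v a) : degOn G (A.erase a) v = degOn G A v := by
  classical
  unfold degOn
  rw [filter_erase, erase_eq_of_notMem]
  simp [h]

theorem not_adj_of_isAcyclic (hG : G.IsAcyclic) {a b c : V} (hab : G.Adj a b)
    (hac : G.Adj a c) : ¬ G.Adj b c := by
  intro hbc
  have := (hG.subsingleton_path _ _).elim (SimpleGraph.Path.singleton hbc)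
    ⟨.cons hab.symm (.cons hac .nil), by
      simp [hab.ne', hac.ne, hbc.ne]⟩
  have := congrArg (fun p => p.1.length) this
  simp [SimpleGraph.Path.singleton] at this

theorem eq_of_isAcyclic (hG : G.IsAcyclic) {a b c d : V} (hac : a ≠ c) (hab : G.Adj a b)
    (hbc : G.Adj b c) (had : G.Adj a d) (hdc : G.Adj d c) : b = d := by
  have := (hG.subsingleton_path _ _).elim (⟨.cons hab (.cons hbc .nil), by simp [hab.ne, hac, hbc.ne]⟩ : G.Path a c)
    ⟨.cons had (.cons hdc .nil), by simp [had.ne, hac, hdc.ne]⟩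
  have := congrArg (fun p => p.1.snd) this
  simpa using this

/-- Both ends of a longest path have at most one neighbor, and one of them is not `p`; if that path
is trivial, there are no edges. Avoiding `p` allows leaves to be pruned while a chosen vertex is
kept. -/
theorem exists_degOn_le_one_aux {W : Type u} {I : SimpleGraph W} [Finite W] [Nontrivial W]
    (hI : I.IsAcyclic) (p : W) :
    ∃ w, w ≠ p ∧ ∀ a b, I.Adj w a → I.Adj w b → a = b := by
  obtain ⟨u, v, q, hq, hmax⟩ := SimpleGraph.Walk.exists_isPath_forall_isPath_length_le_length I
  have key : ∀ {u v : W} (q : I.Walk u v), q.IsPath →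
      (∀ (u' v' : W) (q' : I.Walk u' v'), q'.IsPath → q'.length ≤ q.length) →
      ∀ a b, I.Adj u a → I.Adj u b → a = b := by
    intro u v q hq hmax
    have h1 : ∀ a, I.Adj u a → a = q.snd := by
      intro a ha
      by_cases hs : a ∈ q.support
      · exact hI.eq_snd_of_adj_start hq ha hs
      · have := hmax _ _ (.cons ha.symm q) (by simp [hq, hs])
        simp at this
    intro a b ha hb
    rw [h1 a ha, h1 b hb]
  by_cases huv : u = v
  · subst huv
    have hl : q.length = 0 := by
      have := SimpleGraph.Walk.isPath_iff_nil.1 hq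
      exact SimpleGraph.Walk.length_eq_zero_iff.2 this
    obtain ⟨w, hw⟩ := exists_ne p
    refine ⟨w, hw, fun a b ha _ => ?_⟩
    have := hmax _ _ (SimpleGraph.Path.singleton ha).1 (SimpleGraph.Path.singleton ha).2
    simp [SimpleGraph.Path.singleton, hl] at this
  · by_cases hup : u = p
    · refine ⟨v, fun h => huv (hup.trans h.symm), key q.reverse hq.reverse ?_⟩
      intro u' v' q' h'
      simpa using hmax _ _ q' h'
    · exact ⟨u, hup, key q hq (fun _ _ q' h' => hmax _ _ q' h')⟩

theorem exists_degOn_le_one (hG : G.IsAcyclic) {U : Finset V} (hU : 2 ≤ U.card) (p : V) :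
    ∃ w ∈ U, w ≠ p ∧ degOn G U w ≤ 1 := by
  have hnt : Nontrivial (U : Set V) := by
    obtain ⟨a, ha, b, hb, hab⟩ := one_lt_card.1 hU
    exact ⟨⟨a, ha⟩, ⟨b, hb⟩, by simpa using hab⟩
  have hfin : Finite (U : Set V) := U.finite_toSet
  have hI := hG.induce (U : Set V)
  have main : ∃ w : (U : Set V), (w : V) ≠ p ∧
      ∀ a b, (G.induce (U : Set V)).Adj w a → (G.induce (U : Set V)).Adj w b → a = b := by
    by_cases hp : p ∈ U
    · obtain ⟨w, hw, h⟩ := exists_degOn_le_one_aux hI ⟨p, hp⟩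
      exact ⟨w, fun h' => hw (Subtype.ext h'), h⟩
    · obtain ⟨w, hw, h⟩ := exists_degOn_le_one_aux hI hnt.to_nonempty.some
      exact ⟨w, fun h' => hp (h' ▸ w.2), h⟩
  obtain ⟨w, hw, h⟩ := main
  refine ⟨w, w.2, hw, degOn_le_one_iff.2 fun a ha b hb h1 h2 => ?_⟩
  have := h ⟨a, ha⟩ ⟨b, hb⟩ (by simpa using h1) (by simpa using h2)
  simpa using this

/-- In a forest that is not a star at `p`, some vertex of degree at most one is not adjacent
to `p`. -/
theorem exists_not_adj_degOn_le_one (hG : G.IsAcyclic) (U : Finset V) {p : V} (hp : p ∈ U)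
    (hU : ¬ StarAt G U p) : ∃ z ∈ U, z ≠ p ∧ ¬ G.Adj p z ∧ degOn G U z ≤ 1 := by
  classical
  induction U using Finset.strongInduction with
  | H U ih =>
    have hc : 2 ≤ U.card := by
      unfold StarAt at hU
      push Not at hU
      obtain ⟨v, hv, hvp, -⟩ := hU
      exact one_lt_card.2 ⟨v, hv, p, hp, hvp⟩
    obtain ⟨w, hw, hwp, hd⟩ := exists_degOn_le_one hG hc p
    by_cases ha : G.Adj p w
    · have hU' : ¬ StarAt G (U.erase w) p := by
        intro hs
        refine hU fun v hv hvp => ?_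
        by_cases hvw : v = w
        · exact hvw ▸ ha
        · exact hs v (mem_erase.2 ⟨hvw, hv⟩) hvp
      obtain ⟨z, hz, hzp, hza, hzd⟩ :=
        ih _ (erase_ssubset hw) (mem_erase.2 ⟨hwp.symm, hp⟩) hU'
      have hz' := mem_of_mem_erase hz
      refine ⟨z, hz', hzp, hza, ?_⟩
      -- Within `U` the only neighbor of `w` is `p`, so deleting `w` does not change the degree of
      -- `z`.
      rwa [degOn_erase_of_not_adj] at hzd
      intro hzw
      exact hzp (degOn_le_one_iff.1 hd z hz' p hp hzw.symm ha.symm)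
    · exact ⟨w, hw, hwp, ha, hd⟩

/-- `Grow G A B`: the set `B` arises from `A` by successively adding vertices that have at most
one neighbor in the set they are added to. -/
inductive Grow [DecidableEq V] (G : SimpleGraph V) (A : Finset V) : Finset V → Prop
  | refl : Grow G A A
  | insert {B : Finset V} {w : V} : Grow G A B → w ∉ B → degOn G B w ≤ 1 →
      Grow G A (insert w B)

variable [DecidableEq V]

theorem Grow.subset {A B : Finset V} (h : Grow G A B) : A ⊆ B := by
  induction h with
  | refl => exact Subset.rfl
  | insert _ _ _ ih => exact ih.trans (subset_insert _ _)

theorem Grow.trans {A B C : Finset V} (h : Grow G A B) (h' : Grow G B C) : Grow G A C := by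
  induction h' with
  | refl => exact h
  | insert _ h1 h2 ih => exact ih.insert h1 h2

theorem Grow.of_erase {A : Finset V} {w : V} (hw : w ∈ A) (h : degOn G A w ≤ 1) :
    Grow G (A.erase w) A := by
  have := Grow.insert (G := G) (A := A.erase w) .refl (notMem_erase w A)
    ((degOn_mono (erase_subset _ _) _).trans h)
  rwa [insert_erase hw] at this

/-- Adding vertices that have at most one neighbor in the final set. -/
theorem Grow.sdiff {A : Finset V} (T : Finset V) (hT : T ⊆ A)
    (h : ∀ w ∈ T, degOn G A w ≤ 1) : Grow G (A \ T) A := by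
  induction T using Finset.induction_on with
  | empty => simpa using Grow.refl
  | insert w T hw ih =>
    refine Grow.trans ?_ (ih (fun a ha => hT (mem_insert_of_mem ha))
      fun a ha => h a (mem_insert_of_mem ha))
    rw [sdiff_insert]
    exact .of_erase (by simp [hw, hT (mem_insert_self _ _)])
      ((degOn_mono sdiff_subset _).trans (h w (mem_insert_self _ _)))

theorem Grow.empty (hG : G.IsAcyclic) (U : Finset V) : Grow G ∅ U := by
  induction U using Finset.strongInduction with
  | H U ih =>
    by_cases hc : 2 ≤ U.card
    · obtain ⟨v, hv⟩ : U.Nonempty := card_pos.1 (by lia)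
      obtain ⟨w, hw, -, hd⟩ := exists_degOn_le_one hG hc v
      exact (ih _ (erase_ssubset hw)).trans (.of_erase hw hd)
    · rcases U.eq_empty_or_nonempty with rfl | ⟨v, hv⟩
      · exact .refl
      · exact (ih _ (erase_ssubset hv)).trans
          (.of_erase hv ((degOn_le_card _ _).trans (by lia)))

theorem exists_grow (hG : G.IsAcyclic) (U : Finset V) {p : V} (hp : p ∈ U) {m : ℕ}
    (hm : 1 ≤ m) (hmU : m ≤ U.card) : ∃ A ⊆ U, p ∈ A ∧ A.card = m ∧ Grow G A U := by
  induction U using Finset.strongInduction with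
  | H U ih =>
    by_cases hc : m = U.card
    · exact ⟨U, Subset.rfl, hp, hc.symm, .refl⟩
    · obtain ⟨w, hw, hwp, hd⟩ := exists_degOn_le_one hG (U := U) (by lia) p
      obtain ⟨A, hA, hpA, hAc, hg⟩ := ih _ (erase_ssubset hw) (mem_erase.2 ⟨hwp.symm, hp⟩)
        (by rw [card_erase_of_mem hw]; lia)
      exact ⟨A, hA.trans (erase_subset _ _), hpA, hAc, hg.trans (.of_erase hw hd)⟩

end Forest

/-! ### Extending partial colorings with distinct colors. -/

section Coloring

variable {V : Type u} {Γ : Type w} {G : SimpleGraph V}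

/-- `f` is a coloring of the cover `H` restricted to `U`. -/
def Cover.IsColoringOn (H : Cover G Γ) (U : Finset V) (f : V → Γ) : Prop :=
  (∀ v ∈ U, f v ∈ H.list v) ∧ ∀ u ∈ U, ∀ v ∈ U, ¬ H.graph.Adj (u, f u) (v, f v)

open scoped Classical in
/-- The colors of `w` that are not matched to the colors of the vertices in `A`. -/
noncomputable def Cover.avail (H : Cover G Γ) (A : Finset V) (f : V → Γ) (w : V) : Finset Γ :=
  (H.list w).filter fun β => ∀ u ∈ A, ¬ H.graph.Adj (u, f u) (w, β)

open scoped Classical in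
/-- The restriction of `f` to `U` is strongly `⌈|U| / k⌉`-bounded. -/
def StronglyBoundedOn (U : Finset V) (f : V → Γ) (k : ℕ) : Prop :=
  (∀ α, (U.filter fun v => f v = α).card ≤ U.card / k + 1) ∧
    ((U.image f).filter fun α => (U.filter fun v => f v = α).card = U.card / k + 1).card ≤
      U.card % k

/-- The restriction of `H` to `U` has a strongly bounded coloring. -/
def Cover.ColorableOn (H : Cover G Γ) (U : Finset V) (k : ℕ) : Prop :=
  ∃ f, H.IsColoringOn U f ∧ StronglyBoundedOn U f k

/-- Colors `a` of `y` and `c` of another vertex which together with the color matched to `a`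
exclude at most two colors of `x`. -/
def Cover.Slack (H : Cover G Γ) (x y : V) (a c : Γ) : Prop :=
  a ∉ H.list x ∨ c ∉ H.list x ∨ ∀ β, H.graph.Adj (y, a) (x, β) → β = a ∨ β = c

variable {H : Cover G Γ} {k : ℕ}

theorem Cover.not_graph_adj (H : Cover G Γ) {u v : V} (h : ¬ G.Adj u v) (α β : Γ) :
    ¬ H.graph.Adj (u, α) (v, β) := fun h' => h (H.adj_base h')

/-- By the matching condition a neighbor excludes at most one color, so sending an excluded color to
a vertex excluding it is injective. -/
theorem Cover.card_le_avail (hk : H.IsKCover k) (A : Finset V) (f : V → Γ) (w : V) :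
    k ≤ (H.avail A f w).card + degOn G A w := by
  classical
  have h1 := card_filter_add_card_filter_not (s := H.list w)
    (fun β => ∀ u ∈ A, ¬ H.graph.Adj (u, f u) (w, β))
  rw [hk w] at h1
  have h2 : ((H.list w).filter fun β => ¬ ∀ u ∈ A, ¬ H.graph.Adj (u, f u) (w, β)).card ≤
      degOn G A w := by
    have hex : ∀ β ∈ (H.list w).filter fun β => ¬ ∀ u ∈ A, ¬ H.graph.Adj (u, f u) (w, β),
        ∃ u ∈ A, H.graph.Adj (u, f u) (w, β) := by
      intro β hβ
      have := (mem_filter.1 hβ).2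
      push Not at this
      exact this
    have : Nonempty V := ⟨w⟩
    choose! g hgA hg using hex
    refine card_le_card_of_injOn g (fun β hβ => ?_) fun β hβ β' hβ' h => ?_
    · exact mem_coe.2 (mem_filter.2 ⟨hgA β hβ, (H.adj_base (hg β hβ)).symm⟩)
    · have h1 := hg β hβ
      have h2 := hg β' hβ'
      rw [← h] at h2
      exact H.matching h1 h2
  have h3 : (H.avail A f w).card =
      ((H.list w).filter fun β => ∀ u ∈ A, ¬ H.graph.Adj (u, f u) (w, β)).card := rfl
  lia

/-- If no easy choice exists, every `a ∈ A` is matched to a color `g a ≠ a` of `x`, and `B` lies in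
the list of `x`. Since `g` is injective and `|A| + |B|` exceeds the list size `k`, some `g a` lies
in `B` and serves as `c`. -/
theorem Cover.exists_slack (hk : H.IsKCover k) {x y : V} {A B : Finset Γ}
    (hAB : k < A.card + B.card) (hA : A.card ≤ k) (hBk : B.card ≤ k) (hB : 2 ≤ B.card) :
    ∃ a ∈ A, ∃ c ∈ B, a ≠ c ∧ H.Slack x y a c := by
  classical
  by_cases h1 : ∃ a ∈ A, a ∉ H.list x ∨ ∀ β, H.graph.Adj (y, a) (x, β) → β = a
  · obtain ⟨a, ha, h⟩ := h1
    obtain ⟨c, hc, hca⟩ := exists_mem_ne (by lia : 1 < B.card) a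
    refine ⟨a, ha, c, hc, hca.symm, ?_⟩
    rcases h with h | h
    · exact .inl h
    · exact .inr (.inr fun β hβ => .inl (h β hβ))
  push Not at h1
  obtain ⟨a₀, ha₀⟩ : A.Nonempty := card_pos.1 (by lia)
  by_cases h2 : ∃ c ∈ B, c ∉ H.list x
  · obtain ⟨c, hc, hcx⟩ := h2
    exact ⟨a₀, ha₀, c, hc, fun h => hcx (h ▸ (h1 a₀ ha₀).1), .inr (.inl hcx)⟩
  push Not at h2
  have h3 := fun a ha => (h1 a ha).2
  choose! g hg hga using h3
  have hginj : Set.InjOn g A := fun a ha b hb hab => by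
    have e1 := (hg a ha).symm
    have e2 := (hg b hb).symm
    rw [← hab] at e2
    exact H.matching e1 e2
  have hsub : A.image g ∪ B ⊆ H.list x := union_subset
    (fun c hc => by
      obtain ⟨a, ha, rfl⟩ := mem_image.1 hc
      exact (H.mem_list (hg a ha)).2) h2
  have hne : (A.image g ∩ B).Nonempty := by
    rw [← card_pos]
    have e1 := card_union_add_card_inter (A.image g) B
    have e2 := card_le_card hsub
    rw [hk x] at e2
    rw [card_image_of_injOn hginj] at e1
    lia
  obtain ⟨c, hc⟩ := hne
  obtain ⟨hcA, hcB⟩ := mem_inter.1 hc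
  obtain ⟨a, ha, rfl⟩ := mem_image.1 hcA
  exact ⟨a, ha, g a, hcB, (hga a ha).symm,
    .inr (.inr fun β hβ => .inr (H.matching hβ (hg a ha)))⟩

theorem stronglyBoundedOn_empty (f : V → Γ) : StronglyBoundedOn ∅ f k := by
  simp [StronglyBoundedOn]

theorem stronglyBoundedOn_of_card_lt {U : Finset V} {f : V → Γ} (hU : U.card < k)
    (hf : Set.InjOn f U) : StronglyBoundedOn U f k := by
  classical
  unfold StronglyBoundedOn
  rw [Nat.div_eq_of_lt hU, Nat.mod_eq_of_lt hU]
  refine ⟨fun α => ?_, (card_filter_le _ _).trans card_image_le⟩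
  rw [zero_add, card_le_one]
  intro a ha b hb
  rw [mem_filter] at ha hb
  exact hf ha.1 hb.1 (ha.2.trans hb.2.symm)

variable [DecidableEq V]

theorem Cover.IsColoringOn.update {A : Finset V} {f : V → Γ} (h : H.IsColoringOn A f) {w : V}
    (hw : w ∉ A) {β : Γ} (hβ : β ∈ H.avail A f w) :
    H.IsColoringOn (insert w A) (Function.update f w β) := by
  classical
  have hβ' := mem_filter.1 hβ
  have hne : ∀ v ∈ A, v ≠ w := fun v hv h => hw (h ▸ hv)
  constructor
  · intro v hv
    rcases mem_insert.1 hv with rfl | hv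
    · simpa using hβ'.1
    · rw [Function.update_of_ne (hne v hv)]
      exact h.1 v hv
  · intro u hu v hv
    rcases mem_insert.1 hu with rfl | hu' <;> rcases mem_insert.1 hv with rfl | hv'
    · exact SimpleGraph.irrefl _
    · rw [Function.update_of_ne (hne v hv'), Function.update_self]
      exact fun h' => hβ'.2 v hv' h'.symm
    · rw [Function.update_of_ne (hne u hu'), Function.update_self]
      exact hβ'.2 u hu'
    · rw [Function.update_of_ne (hne v hv'), Function.update_of_ne (hne u hu')]
      exact h.2 u hu' v hv'

theorem eqOn_update {A : Finset V} {w : V} (hw : w ∉ A) (f : V → Γ) (β : Γ) :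
    Set.EqOn (Function.update f w β) f A :=
  fun v hv => Function.update_of_ne (by rintro rfl; exact hw hv) _ _

theorem injOn_insert_update {C : Finset V} {w : V} (hw : w ∉ C) {f : V → Γ} {β : Γ}
    (hf : Set.InjOn f C) (hβ : ∀ v ∈ C, f v ≠ β) :
    Set.InjOn (Function.update f w β) (insert w C : Finset V) := by
  rw [coe_insert, Set.injOn_insert (by simpa using hw)]
  refine ⟨hf.congr (eqOn_update hw f β).symm, ?_⟩
  rintro ⟨v, hv, h⟩
  rw [eqOn_update hw f β hv, Function.update_self] at h
  exact hβ v hv h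

theorem Cover.IsColoringOn.extend (hk : H.IsKCover k) {A C : Finset V} {f : V → Γ}
    (h : H.IsColoringOn A f) (hCA : C ⊆ A) (hf : Set.InjOn f C) {w : V} (hw : w ∉ A)
    (hd : C.card + degOn G A w < k) :
    ∃ g, Set.EqOn g f A ∧ H.IsColoringOn (insert w A) g ∧
      Set.InjOn g (insert w C : Finset V) := by
  classical
  have h1 := H.card_le_avail hk A f w
  obtain ⟨β, hβ, hβ'⟩ : ∃ β ∈ H.avail A f w, β ∉ C.image f :=
    exists_mem_notMem_of_card_lt_card (by have := card_image_le (s := C) (f := f); lia)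
  refine ⟨Function.update f w β, eqOn_update hw f β, h.update hw hβ,
    injOn_insert_update (fun h => hw (hCA h)) hf fun v hv h => hβ' ?_⟩
  exact mem_image.2 ⟨v, hv, h⟩

/-- A new vertex avoids at most `k - 2` colors already used on the block and one color matched to
its at most one earlier neighbor. -/
theorem Cover.IsColoringOn.extend_grow (hk : H.IsKCover k) {A B C : Finset V} {f : V → Γ}
    (h : H.IsColoringOn A f) (hCA : C ⊆ A) (hf : Set.InjOn f C) (hg : Grow G A B)
    (hd : C.card + (B \ A).card < k) :
    ∃ g, Set.EqOn g f A ∧ H.IsColoringOn B g ∧ Set.InjOn g (C ∪ B \ A : Finset V) := by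
  induction hg with
  | refl => exact ⟨f, fun _ _ => rfl, h, by simpa using hf⟩
  | @insert B w hg hw hdw ih =>
    have hwA : w ∉ A := fun h => hw (hg.subset h)
    have e : insert w B \ A = insert w (B \ A) := insert_sdiff_of_notMem _ hwA
    rw [e, card_insert_of_notMem (by simp [hw])] at hd
    obtain ⟨g, h1, h2, h3⟩ := ih (by lia)
    obtain ⟨g', h1', h2', h3'⟩ := h2.extend hk (C := C ∪ B \ A)
      (union_subset (hCA.trans hg.subset) sdiff_subset) h3 hw (by
        have := card_union_le C (B \ A)
        lia)
    refine ⟨g', fun v hv => (h1' (hg.subset hv)).trans (h1 hv), h2', ?_⟩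
    rwa [e, union_insert]

/-- The last vertex `x`, of degree at most one, of a block of `k` vertices with distinct
colors. -/
theorem Cover.IsColoringOn.extend_last (hk : H.IsKCover k) {A C : Finset V} {f : V → Γ}
    (h : H.IsColoringOn A f) (hCA : C ⊆ A) (hf : Set.InjOn f C) {x y z : V} (hx : x ∉ A)
    (hy : y ∈ C) (hz : z ∈ C) (hxy : ∀ v ∈ A, G.Adj x v → v = y)
    (hs : H.Slack x y (f y) (f z)) (hC : C.card < k) :
    ∃ g, Set.EqOn g f A ∧ H.IsColoringOn (insert x A) g ∧
      Set.InjOn g (insert x C : Finset V) := by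
  classical
  obtain ⟨β, hβ, hβC, hβy⟩ : ∃ β ∈ H.list x, β ∉ C.image f ∧ ¬ H.graph.Adj (y, f y) (x, β) := by
    have hc : (C.image f).card < k := card_image_le.trans_lt hC
    have hfy : f y ∈ C.image f := mem_image_of_mem f hy
    have hfz : f z ∈ C.image f := mem_image_of_mem f hz
    -- A block color outside the list of `x` costs nothing there, so two unused colors remain and at
    -- most one of them is matched to `f y`.
    have erase : ∀ c ∈ C.image f, c ∉ H.list x →
        ∃ β ∈ H.list x, β ∉ C.image f ∧ ¬ H.graph.Adj (y, f y) (x, β) := by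
      intro c hc' hcx
      have h2 : 1 < (H.list x \ (C.image f).erase c).card := by
        have := le_card_sdiff ((C.image f).erase c) (H.list x)
        rw [hk x, card_erase_of_mem hc'] at this
        have := card_pos.2 ⟨c, hc'⟩
        lia
      obtain ⟨b, hb, b', hb', hbb⟩ := one_lt_card.1 h2
      simp only [mem_sdiff, mem_erase, not_and, ne_eq] at hb hb'
      have hn : ∀ b, b ∈ H.list x → b ≠ c := fun b hb h => hcx (h ▸ hb)
      by_cases hadj : H.graph.Adj (y, f y) (x, b)
      · exact ⟨b', hb'.1, hb'.2 (hn _ hb'.1), fun h' => hbb (H.matching hadj h')⟩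
      · exact ⟨b, hb.1, hb.2 (hn _ hb.1), hadj⟩
    rcases hs with hs | hs | hs
    · exact erase _ hfy hs
    · exact erase _ hfz hs
    -- A color matched to `f y` is `f y` or `f z`, hence already avoided.
    · obtain ⟨β, hβ, hβ'⟩ := exists_mem_notMem_of_card_lt_card (hc.trans_eq (hk x).symm)
      refine ⟨β, hβ, hβ', fun h' => ?_⟩
      rcases hs β h' with rfl | rfl
      · exact hβ' hfy
      · exact hβ' hfz
  refine ⟨Function.update f x β, eqOn_update hx f β, h.update hx (mem_filter.2 ⟨hβ, ?_⟩),
    injOn_insert_update (fun h => hx (hCA h)) hf fun v hv h => hβC (mem_image.2 ⟨v, hv, h⟩)⟩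
  intro u hu hadj
  obtain rfl := hxy u hu (H.adj_base hadj).symm
  exact hβy hadj

/-- Colors for two non-adjacent vertices `y` and `z` that leave slack at `x`. -/
theorem Cover.IsColoringOn.extend_pair (hk : H.IsKCover k) {R : Finset V} {f : V → Γ}
    (h : H.IsColoringOn R f) {x y z : V} (hy : y ∉ R) (hz : z ∉ R) (hyz : y ≠ z)
    (hadj : ¬ G.Adj y z) (hd : degOn G R y + degOn G R z < k) (hdz : degOn G R z + 2 ≤ k) :
    ∃ g, Set.EqOn g f R ∧ H.IsColoringOn (insert z (insert y R)) g ∧ g y ≠ g z ∧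
      H.Slack x y (g y) (g z) := by
  classical
  have h1 := H.card_le_avail hk R f y
  have h2 := H.card_le_avail hk R f z
  have h3 : ∀ v, (H.avail R f v).card ≤ k := fun v =>
    (card_le_card (filter_subset _ _)).trans_eq (hk v)
  obtain ⟨a, ha, c, hc, hac, hs⟩ := Cover.exists_slack hk (x := x) (y := y)
    (A := H.avail R f y) (B := H.avail R f z) (by lia) (h3 y) (h3 z) (by lia)
  have hz' : z ∉ insert y R := by simp [hyz.symm, hz]
  refine ⟨Function.update (Function.update f y a) z c, fun v hv => ?_,
    (h.update hy ha).update hz' ?_, ?_, ?_⟩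
  · rw [eqOn_update hz' _ _ (mem_coe.2 (mem_insert_of_mem hv)), eqOn_update hy _ _ hv]
  · have hc' := mem_filter.1 hc
    refine mem_filter.2 ⟨hc'.1, fun u hu => ?_⟩
    rcases mem_insert.1 hu with rfl | hu
    · exact H.not_graph_adj hadj _ _
    · rw [eqOn_update hy f a hu]
      exact hc'.2 u hu
  · simpa [Function.update_of_ne hyz] using hac
  · simpa [Function.update_of_ne hyz] using hs

/-- The threshold for a large class rises by one and each class grows by at most one, so a class
large in `R ∪ S` was already large in `R`. -/
theorem StronglyBoundedOn.union {R S : Finset V} {f g : V → Γ} (hk : 0 < k)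
    (h : StronglyBoundedOn R f k) (hgf : Set.EqOn g f R) (hRS : Disjoint R S)
    (hS : S.card = k) (hg : Set.InjOn g S) : StronglyBoundedOn (R ∪ S) g k := by
  classical
  have hq : (R ∪ S).card / k = R.card / k + 1 := by
    rw [card_union_of_disjoint hRS, hS, Nat.add_div_right _ hk]
  have hr : (R ∪ S).card % k = R.card % k := by
    rw [card_union_of_disjoint hRS, hS, Nat.add_mod_right]
  have hc : ∀ α, ((R ∪ S).filter fun v => g v = α).card ≤
      (R.filter fun v => f v = α).card + 1 := by
    intro α
    rw [filter_union]
    refine (card_union_le _ _).trans ?_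
    have e : (R.filter fun v => g v = α) = R.filter fun v => f v = α :=
      filter_congr fun v hv => by rw [hgf hv]
    have e' : (S.filter fun v => g v = α).card ≤ 1 := by
      rw [card_le_one]
      intro a ha b hb
      rw [mem_filter] at ha hb
      exact hg ha.1 hb.1 (ha.2.trans hb.2.symm)
    rw [e]
    lia
  unfold StronglyBoundedOn
  rw [hq, hr]
  refine ⟨fun α => (hc α).trans (by have := h.1 α; lia), le_trans (card_le_card ?_) h.2⟩
  intro α hα
  have h1 := (mem_filter.1 hα).2
  have h2 := hc α
  have h3 := h.1 α
  have h4 : (R.filter fun v => f v = α).card = R.card / k + 1 := by lia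
  refine mem_filter.2 ⟨?_, h4⟩
  obtain ⟨v, hv⟩ := card_pos.1 (by lia : 0 < (R.filter fun v => f v = α).card)
  exact mem_image.2 ⟨v, (mem_filter.1 hv).1, (mem_filter.1 hv).2⟩

end Coloring

/-! ### Coloring one block, and the cases of at most `k` vertices. -/

section Block

variable {V : Type u} {Γ : Type w} {G : SimpleGraph V} {H : Cover G Γ} {k : ℕ}

/-- If `R` is colored and the remaining `k` vertices of `U` get distinct colors, then the coloring
stays strongly bounded. -/
theorem Cover.ColorableOn.of_block [DecidableEq V] (hk : H.IsKCover k) (hk4 : 4 ≤ k)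
    {U B : Finset V} {x y z : V}
    (hx : x ∈ U) (hg : Grow G B (U.erase x)) (hB : (U.erase x \ B).card + 3 = k)
    (hy : y ∈ B) (hz : z ∈ B) (hyz : y ≠ z) (hadj : ¬ G.Adj y z)
    (hxy : ∀ v ∈ U, G.Adj x v → v = y) (hd : degOn G B y + degOn G B z < k)
    (hdz : degOn G B z + 2 ≤ k) (hR : H.ColorableOn ((B.erase y).erase z) k) :
    H.ColorableOn U k := by
  set R := (B.erase y).erase z with hRdef
  obtain ⟨f, hf, hfs⟩ := hR
  have hRB : R ⊆ B := (erase_subset _ _).trans (erase_subset _ _)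
  have hyR : y ∉ R := by simp [hRdef]
  have hzR : z ∉ R := by simp [hRdef]
  have hBR : insert z (insert y R) = B := by
    rw [insert_comm, hRdef, insert_erase (mem_erase.2 ⟨hyz.symm, hz⟩), insert_erase hy]
  obtain ⟨g, hgf, hg1, hgyz, hs⟩ := hf.extend_pair hk (x := x) hyR hzR hyz hadj
    (by have := degOn_mono (G := G) hRB y; have := degOn_mono (G := G) hRB z; lia)
    (by have := degOn_mono (G := G) hRB z; lia)
  rw [hBR] at hg1
  have hyzB : ({y, z} : Finset V) ⊆ B := by
    intro v hv
    rcases mem_insert.1 hv with rfl | hv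
    · exact hy
    · exact mem_singleton.1 hv ▸ hz
  have hinj : Set.InjOn g ({y, z} : Finset V) := by
    intro a ha b hb hab
    simp only [coe_insert, coe_singleton, Set.mem_insert_iff, Set.mem_singleton_iff] at ha hb
    rcases ha with rfl | rfl <;> rcases hb with rfl | rfl
    · rfl
    · exact absurd hab hgyz
    · exact absurd hab.symm hgyz
    · rfl
  obtain ⟨g₂, h2g, h2, h2i⟩ := hg1.extend_grow hk hyzB hinj hg (by rw [card_pair hyz]; lia)
  have hdisj : Disjoint ({y, z} : Finset V) (U.erase x \ B) := disjoint_sdiff.mono_left hyzB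
  have hcard : ({y, z} ∪ U.erase x \ B).card = k - 1 := by
    rw [card_union_of_disjoint hdisj, card_pair hyz]
    lia
  have hCA : {y, z} ∪ U.erase x \ B ⊆ U.erase x :=
    union_subset (hyzB.trans hg.subset) sdiff_subset
  obtain ⟨g₃, h3g, h3, h3i⟩ := h2.extend_last hk hCA h2i (notMem_erase x U) (y := y) (z := z)
    (by simp) (by simp) (fun v hv => hxy v (mem_of_mem_erase hv))
    (by rw [h2g hy, h2g hz]; exact hs) (by lia)
  rw [insert_erase hx] at h3
  have hU : R ∪ insert x ({y, z} ∪ U.erase x \ B) = U := by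
    have : R ∪ {y, z} = B := by rw [← hBR]; ext v; simp; tauto
    rw [union_insert, ← union_assoc, this, union_sdiff_of_subset hg.subset, insert_erase hx]
  refine ⟨g₃, h3, ?_⟩
  rw [← hU]
  refine hfs.union (by lia) (fun v hv => ?_) ?_ ?_ h3i
  · rw [h3g (hg.subset (hRB hv)), h2g (hRB hv), hgf hv]
  · rw [disjoint_insert_right, disjoint_union_right]
    refine ⟨fun h => ?_, ?_, disjoint_sdiff.mono_left hRB⟩
    · exact notMem_erase x U (hg.subset (hRB h))
    · simp [hyR, hzR]
  · rw [card_insert_of_notMem fun h => notMem_erase x U (hCA h), hcard]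
    lia

theorem Cover.ColorableOn.of_injOn (hk : 0 < k) {U : Finset V} {f : V → Γ}
    (hU : U.card = k) (h : H.IsColoringOn U f) (hf : Set.InjOn f U) : H.ColorableOn U k := by
  classical
  refine ⟨f, h, ?_⟩
  have := (stronglyBoundedOn_empty (k := k) f).union hk (fun _ _ => rfl)
    (disjoint_empty_left U) hU hf
  rwa [empty_union] at this

/-- Used for a path `x, y, u, z`: `a` is the color of `y`, `b` and `c` are candidates for `u`, and
`L`, `M` are the lists of `x`, `z`. If `g` fails, then `L = {a, g, m, d}` and `M = {a, g, d, e}`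
with `P m` and `Q g e`. If both candidates fail, `m` is common to both; comparing the lists gives `d
= c` for `b` and `d = b` for `c`. Then both descriptions of `M` have the same `e`, which is matched
to `b` and to `c`. -/
theorem exists_distinct_colors {L M : Finset Γ} (hL : L.card = 4) (hM : M.card = 4) {a b c : Γ}
    (hab : a ≠ b) (hac : a ≠ c) (hbc : b ≠ c) {P : Γ → Prop} {Q : Γ → Γ → Prop}
    (hP : ∀ d e, P d → P e → d = e) (hQ : ∀ d e e', Q d e → Q d e' → e = e')
    (hQ' : ∀ d d' e, Q d e → Q d' e → d = d') :
    ∃ g, (g = b ∨ g = c) ∧ ∃ d ∈ L, ∃ e ∈ M, d ≠ e ∧ d ≠ a ∧ d ≠ g ∧ e ≠ a ∧ e ≠ g ∧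
      ¬ P d ∧ ¬ Q g e := by
  classical
  by_contra! hcon
  have fill : ∀ (N : Finset Γ) (T : Γ → Prop), N.card = 4 → (∀ d e, T d → T e → d = e) →
      ∀ s t : Γ, ∃ d ∈ N, d ≠ s ∧ d ≠ t ∧ ¬ T d := by
    intro N T hN hT s t
    obtain ⟨d, hd, e, he, hde⟩ := one_lt_card.1
      (by have := le_card_sdiff {s, t} N; have := card_le_two (a := s) (b := t); lia :
        1 < (N \ {s, t}).card)
    simp only [mem_sdiff, mem_insert, mem_singleton, not_or] at hd he
    by_cases h : T d
    · exact ⟨e, he.1, he.2.1, he.2.2, fun h' => hde (hT _ _ h h')⟩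
    · exact ⟨d, hd.1, hd.2.1, hd.2.2, h⟩
  have key : ∀ g, (g = b ∨ g = c) → ∃ m d e : Γ, P m ∧ Q g e ∧
      L = {a, g, m, d} ∧ M = {a, g, d, e} := by
    intro g hg
    obtain ⟨d, hd, hda, hdg, hdP⟩ := fill L P hL hP a g
    obtain ⟨e, he, hea, heg, heQ⟩ := fill M (Q g) hM (hQ g) a g
    have hde : d = e := by
      by_contra hde
      exact heQ (hcon g hg d hd e he hde hda hdg hea heg hdP)
    subst hde
    have other : ∀ (N : Finset Γ), N.card = 4 → ∃ m ∈ N, m ∉ ({a, g, d} : Finset Γ) := by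
      intro N hN
      exact exists_mem_notMem_of_card_lt_card (by
        have := card_le_three (a := a) (b := g) (c := d); lia)
    obtain ⟨m, hm, hm'⟩ := other L hL
    obtain ⟨e, he', he''⟩ := other M hM
    simp only [mem_insert, mem_singleton, not_or] at hm' he''
    have hmP : P m := by
      by_contra hmP
      exact heQ (hcon g hg m hm d he hm'.2.2 hm'.1 hm'.2.1 hda hdg hmP)
    have heQ' : Q g e :=
      hcon g hg d hd e he' (Ne.symm he''.2.2) hda hdg he''.1 he''.2.1 hdP
    refine ⟨m, d, e, hmP, heQ', ?_, ?_⟩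
    · refine eq_of_subset_of_card_le (fun t ht => ?_) (card_le_four.trans hL.ge)
      by_contra ht'
      simp only [mem_insert, mem_singleton, not_or] at ht'
      by_cases htP : P t
      · exact ht'.2.2.1 (hP _ _ htP hmP)
      · exact heQ (hcon g hg t ht d he ht'.2.2.2 ht'.1 ht'.2.1 hda hdg htP)
    · refine eq_of_subset_of_card_le (fun t ht => ?_) (card_le_four.trans hM.ge)
      by_contra ht'
      simp only [mem_insert, mem_singleton, not_or] at ht'
      have := hcon g hg d hd t ht (Ne.symm ht'.2.2.1) hda hdg ht'.1 ht'.2.1 hdP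
      exact ht'.2.2.2 (hQ _ _ _ this heQ')
  obtain ⟨m, d, e, hm, he, hL1, hM1⟩ := key b (.inl rfl)
  obtain ⟨m', d', e', hm', he', hL2, hM2⟩ := key c (.inr rfl)
  obtain rfl := hP _ _ hm hm'
  have hee : e ≠ e' := fun h => hbc (hQ' _ _ _ he (h ▸ he'))
  have card4 : ∀ s t v w : Γ, ({s, t, v, w} : Finset Γ).card = 4 →
      s ≠ v ∧ s ≠ w ∧ t ≠ v ∧ t ≠ w ∧ v ≠ w := by
    intro s t v w h
    refine ⟨?_, ?_, ?_, ?_, ?_⟩ <;> rintro rfl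
    · have := card_le_three (a := s) (b := t) (c := w)
      rw [show ({s, t, s, w} : Finset Γ) = {s, t, w} by ext; simp; tauto] at h
      lia
    · have := card_le_three (a := s) (b := t) (c := v)
      rw [show ({s, t, v, s} : Finset Γ) = {s, t, v} by ext; simp; tauto] at h
      lia
    · have := card_le_three (a := s) (b := t) (c := w)
      rw [show ({s, t, t, w} : Finset Γ) = {s, t, w} by ext; simp] at h
      lia
    · have := card_le_three (a := s) (b := t) (c := v)
      rw [show ({s, t, v, t} : Finset Γ) = {s, t, v} by ext; simp; tauto] at h
      lia
    · have := card_le_three (a := s) (b := t) (c := v)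
      rw [show ({s, t, v, v} : Finset Γ) = {s, t, v} by ext; simp] at h
      lia
  have n1 := card4 _ _ _ _ (hL1 ▸ hL)
  have n2 := card4 _ _ _ _ (hL2 ▸ hL)
  have n3 := card4 _ _ _ _ (hM1 ▸ hM)
  have n4 := card4 _ _ _ _ (hM2 ▸ hM)
  have e1 : c = d := by
    have : c ∈ ({a, b, m, d} : Finset Γ) := by rw [← hL1, hL2]; simp
    simp only [mem_insert, mem_singleton] at this
    rcases this with h | h | h | h
    · exact absurd h.symm hac
    · exact absurd h.symm hbc
    · exact absurd h n2.2.2.1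
    · exact h
  have e2 : e' = e := by
    have h1 : e' ∈ ({a, b, d, e} : Finset Γ) := by rw [← hM1, hM2]; simp
    have h2 : b = d' := by
      have : b ∈ ({a, c, m, d'} : Finset Γ) := by rw [← hL2, hL1]; simp
      simp only [mem_insert, mem_singleton] at this
      rcases this with h | h | h | h
      · exact absurd h.symm hab
      · exact absurd h hbc
      · exact absurd h n1.2.2.1
      · exact h
    simp only [mem_insert, mem_singleton] at h1
    rcases h1 with h | h | h | h
    · exact absurd h.symm n4.2.1
    · exact absurd (h2.symm.trans h.symm) n4.2.2.2.2
    · exact absurd (e1.trans h.symm) n4.2.2.2.1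
    · exact h
  exact hee e2.symm

/-- A path on four vertices has a coloring with distinct colors. -/
theorem Cover.exists_isColoringOn_path [DecidableEq V] (hk : H.IsKCover 4) {x y u z : V}
    (hxy : x ≠ y) (hxu : x ≠ u) (hxz : x ≠ z) (hyu : y ≠ u) (hyz : y ≠ z) (huz : u ≠ z)
    (axu : ¬ G.Adj u x) (axz : ¬ G.Adj x z) (ayz : ¬ G.Adj y z) :
    ∃ f, H.IsColoringOn {z, x, u, y} f ∧ Set.InjOn f ({z, x, u, y} : Finset V) := by
  classical
  obtain ⟨a, ha⟩ : (H.list y).Nonempty := card_pos.1 (by rw [hk y]; lia)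
  have h0 : H.IsColoringOn {y} (fun _ => a) := by
    refine ⟨by simpa using ha, ?_⟩
    simp
  have h1 := H.card_le_avail hk {y} (fun _ => a) u
  have h2 : degOn G {y} u ≤ 1 := (degOn_le_card _ _).trans (by simp)
  obtain ⟨b, hb, c, hc, hbc⟩ := one_lt_card.1
    (by have := pred_card_le_card_erase (s := H.avail {y} (fun _ => a) u) (a := a); lia :
      1 < ((H.avail {y} (fun _ => a) u).erase a).card)
  rw [mem_erase] at hb hc
  obtain ⟨g, hg, d, hd, e, he, hde, hda, hdg, hea, heg, hdP, heQ⟩ :=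
    exists_distinct_colors (hk x) (hk z) hb.1.symm hc.1.symm hbc
      (P := fun d => H.graph.Adj (y, a) (x, d)) (Q := fun g e => H.graph.Adj (u, g) (z, e))
      (fun d e h h' => H.matching h h') (fun d e e' h h' => H.matching h h')
      (fun d d' e h h' => H.matching h.symm h'.symm)
  have hga : g ≠ a ∧ g ∈ H.avail {y} (fun _ => a) u := by
    rcases hg with rfl | rfl
    · exact hb
    · exact hc
  have hu : u ∉ ({y} : Finset V) := by simp [hyu.symm]
  have hx : x ∉ ({u, y} : Finset V) := by simp [hxu, hxy]
  have hz : z ∉ ({x, u, y} : Finset V) := by simp [hxz.symm, huz.symm, hyz.symm]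
  have c1 := h0.update hu hga.2
  have c2 := c1.update hx (β := d) (mem_filter.2 ⟨hd, by
    intro v hv
    simp only [mem_insert, mem_singleton] at hv
    rcases hv with rfl | rfl
    · exact H.not_graph_adj axu _ _
    · rwa [Function.update_of_ne hyu]⟩)
  have c3 := c2.update hz (β := e) (mem_filter.2 ⟨he, by
    intro v hv
    simp only [mem_insert, mem_singleton] at hv
    rcases hv with rfl | rfl | rfl
    · exact H.not_graph_adj axz _ _
    · rwa [Function.update_of_ne hxu.symm, Function.update_self]
    · exact H.not_graph_adj ayz _ _⟩)
  refine ⟨_, c3, injOn_insert_update hz (injOn_insert_update hx (injOn_insert_update hu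
    (by simp) ?_) ?_) ?_⟩
  · simpa using hga.1.symm
  · intro v hv
    simp only [mem_insert, mem_singleton] at hv
    rcases hv with rfl | rfl
    · simpa using hdg.symm
    · simpa [Function.update_of_ne hyu] using hda.symm
  · intro v hv
    simp only [mem_insert, mem_singleton] at hv
    rcases hv with rfl | rfl | rfl
    · simpa using hde
    · simpa [Function.update_of_ne hxu.symm] using heg.symm
    · simpa [Function.update_of_ne hyu, Function.update_of_ne hxy.symm] using hea.symm

/-- Leaves other than `y` are pruned until deleting one more would leave a star at `y`; that leaf is
`z`. -/
theorem exists_grow_star [DecidableEq V] (hG : G.IsAcyclic) (A : Finset V) {y : V} (hy : y ∈ A)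
    (hA : ¬ StarAt G A y) : ∃ B z, Grow G B A ∧ y ∈ B ∧ z ∈ B ∧ z ≠ y ∧ ¬ G.Adj y z ∧
      degOn G B z ≤ 1 ∧ StarAt G (B.erase z) y := by
  induction A using Finset.strongInduction with
  | H A ih =>
    have hc : 2 ≤ A.card := by
      unfold StarAt at hA
      push Not at hA
      obtain ⟨v, hv, hvp, -⟩ := hA
      exact one_lt_card.2 ⟨v, hv, y, hy, hvp⟩
    obtain ⟨w, hw, hwy, hd⟩ := exists_degOn_le_one hG hc y
    by_cases hs : StarAt G (A.erase w) y
    · refine ⟨A, w, .refl, hy, hw, hwy, fun h => hA fun v hv hvy => ?_, hd, hs⟩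
      by_cases hvw : v = w
      · exact hvw ▸ h
      · exact hs v (mem_erase.2 ⟨hvw, hv⟩) hvy
    · obtain ⟨B, z, h1, h2⟩ := ih _ (erase_ssubset hw) (mem_erase.2 ⟨hwy.symm, hy⟩) hs
      exact ⟨B, z, h1.trans (.of_erase hw hd), h2⟩

theorem Cover.colorableOn_of_card_lt (hG : G.IsAcyclic) (hk : H.IsKCover k) {U : Finset V}
    (hU : U.card < k) : H.ColorableOn U k := by
  classical
  have hΓ : Nonempty (V → Γ) := by
    refine ⟨fun v => ?_⟩
    have : (H.list v).Nonempty := card_pos.1 (by rw [hk v]; lia)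
    exact this.choose
  obtain ⟨f⟩ := hΓ
  obtain ⟨g, -, hg, hgi⟩ := Cover.IsColoringOn.extend_grow hk (A := ∅) (C := ∅) (f := f)
    ⟨by simp, by simp⟩ Subset.rfl (by simp) (Grow.empty hG U) (by simpa using hU)
  exact ⟨g, hg, stronglyBoundedOn_of_card_lt hU (by simpa using hgi)⟩

/-- When `x` has a neighbor `y`, pruning leaves a star at `y` plus one vertex `z`. If `z` is
isolated there, the block argument applies with nothing left over. Otherwise `z` hangs on a neighbor
`u` of `y`, and `u` is colored right after `y` and `z`; for `k = 4` the whole set is the path `x, y,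
u, z`. -/
theorem Cover.colorableOn_of_card_eq (hG : G.IsAcyclic) (hk : H.IsKCover k) (hk4 : 4 ≤ k)
    {U : Finset V} (hU : U.card = k) (hs : ∀ c ∈ U, ¬ StarAt G U c) : H.ColorableOn U k := by
  classical
  have hΓ : Nonempty (V → Γ) := by
    refine ⟨fun v => ?_⟩
    have : (H.list v).Nonempty := card_pos.1 (by rw [hk v]; lia)
    exact this.choose
  obtain ⟨f⟩ := hΓ
  have hf : H.IsColoringOn ∅ f := ⟨by simp, by simp⟩
  obtain ⟨p, hp⟩ : U.Nonempty := card_pos.1 (by lia)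
  obtain ⟨x, hx, -, hdx⟩ := exists_degOn_le_one hG (U := U) (by lia) p
  have hxc : (U.erase x).card + 1 = k := by rw [card_erase_add_one hx, hU]
  by_cases hiso : ∃ y ∈ U, G.Adj x y
  swap
  · push Not at hiso
    obtain ⟨g, -, hg, hgi⟩ := hf.extend_grow hk (C := ∅) Subset.rfl (by simp)
      (Grow.empty hG (U.erase x)) (by simp; lia)
    rw [sdiff_empty, empty_union] at hgi
    have h0 : degOn G (U.erase x) x = 0 := by
      unfold degOn
      rw [card_eq_zero, filter_eq_empty_iff]
      exact fun v hv => hiso v (mem_of_mem_erase hv)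
    obtain ⟨g', -, hg', hgi'⟩ := hg.extend hk Subset.rfl hgi (notMem_erase x U) (by lia)
    rw [insert_erase hx] at hg' hgi'
    exact .of_injOn (by lia) hU hg' hgi'
  obtain ⟨y, hy, hxy⟩ := hiso
  have hxy' : ∀ v ∈ U, G.Adj x v → v = y := fun v hv h => degOn_le_one_iff.1 hdx v hv y hy h hxy
  have hyx : y ∈ U.erase x := mem_erase.2 ⟨hxy.ne', hy⟩
  obtain ⟨B, z, hg, hyB, hzB, hzy, hyz, hdz, hst⟩ := exists_grow_star hG (U.erase x) hyx
    (fun h => hs y hy fun v hv hvy => by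
      by_cases hvx : v = x
      · exact hvx ▸ hxy.symm
      · exact h v (mem_erase.2 ⟨hvx, hv⟩) hvy)
  have hBy : ∀ w ∈ B, w ≠ y → w ≠ z → G.Adj y w := fun w hw hwy hwz =>
    hst w (mem_erase.2 ⟨hwz, hw⟩) hwy
  have hleaf : ∀ w ∈ B, w ≠ y → w ≠ z → ¬ G.Adj w z → degOn G B w ≤ 1 := by
    intro w hw hwy hwz hadj
    have : ∀ a ∈ B, G.Adj w a → a = y := by
      intro a ha hwa
      by_contra hay
      have haz : a ≠ z := by rintro rfl; exact hadj hwa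
      exact not_adj_of_isAcyclic hG (hBy w hw hwy hwz) (hBy a ha hay haz) hwa
    exact degOn_le_one_iff.2 fun a ha b hb h1 h2 => (this a ha h1).trans (this b hb h2).symm
  have hsub2 : ({y, z} : Finset V) ⊆ B := by
    intro v hv
    rcases mem_insert.1 hv with rfl | hv
    · exact hyB
    · exact mem_singleton.1 hv ▸ hzB
  by_cases hu : ∃ u ∈ B, G.Adj z u
  swap
  · push Not at hu
    have hg2 : Grow G {y, z} B := by
      have := Grow.sdiff (G := G) (A := B) (B \ {y, z}) sdiff_subset (by
        intro w hw
        simp only [mem_sdiff, mem_insert, mem_singleton, not_or] at hw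
        exact hleaf w hw.1 hw.2.1 hw.2.2 fun h => hu w hw.1 h.symm)
      rwa [Finset.sdiff_sdiff_eq_self hsub2] at this
    have d0 : degOn G {y, z} y = 0 := by
      unfold degOn
      rw [card_eq_zero, filter_eq_empty_iff]
      simp [hyz]
    have d1 : degOn G {y, z} z = 0 := by
      unfold degOn
      rw [card_eq_zero, filter_eq_empty_iff]
      simpa [G.adj_comm z y] using hyz
    have hg3 := hg2.trans hg
    refine .of_block hk hk4 hx hg3 ?_ (y := y) (z := z) (by simp) (by simp) hzy.symm hyz hxy'
      (by lia) (by lia) ?_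
    · rw [card_sdiff_of_subset hg3.subset, card_pair hzy.symm]
      lia
    · have : (({y, z} : Finset V).erase y).erase z = ∅ := by
        ext v
        simp
        tauto
      rw [this]
      exact Cover.colorableOn_of_card_lt hG hk (by simp; lia)
  obtain ⟨u, hu, hzu⟩ := hu
  have huy : u ≠ y := by rintro rfl; exact hyz hzu.symm
  have hyu := hBy u hu huy hzu.ne'
  have hxB : x ∉ B := fun h => notMem_erase x U (hg.subset h)
  have hxu : x ≠ u := by rintro rfl; exact hxB hu
  have hxz : x ≠ z := by rintro rfl; exact hxB hzB
  have hzU : z ∈ U := mem_of_mem_erase (hg.subset hzB)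
  have huU : u ∈ U := mem_of_mem_erase (hg.subset hu)
  rcases Nat.lt_or_ge k 5 with hk5 | hk5
  · obtain rfl : k = 4 := by lia
    obtain ⟨f, h1, h2⟩ := Cover.exists_isColoringOn_path hk hxy.ne hxu hxz hyu.ne hzy.symm hzu.ne'
      (fun h => huy (hxy' u huU h.symm)) (fun h => hzy (hxy' z hzU h)) hyz
    have hU4 : ({z, x, u, y} : Finset V) = U := by
      refine eq_of_subset_of_card_le ?_ ?_
      · intro v hv
        simp only [mem_insert, mem_singleton] at hv
        rcases hv with rfl | rfl | rfl | rfl <;> assumption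
      · rw [hU, card_insert_of_notMem, card_insert_of_notMem, card_pair huy]
        · simp [hxu, hxy.ne]
        · simp [hxz.symm, hzu.ne, hzy]
    rw [hU4] at h1 h2
    exact .of_injOn (by lia) hU h1 h2
  · obtain ⟨g, -, hgc, hgyz, hsl⟩ := hf.extend_pair hk (x := x) (y := y) (z := z) (by simp)
      (by simp) hzy.symm hyz (by simp [degOn]; lia) (by simp [degOn]; lia)
    rw [insert_empty] at hgc
    have hinj : Set.InjOn g ({z, y} : Finset V) := by
      rw [coe_insert, coe_singleton, Set.injOn_pair]
      exact fun h => absurd h.symm hgyz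
    -- Here `u` has two colored neighbors and two more colors to avoid, hence the need for `5 ≤ k`.
    obtain ⟨g₁, e1, c1, i1⟩ := hgc.extend hk Subset.rfl hinj (w := u)
      (by simp [huy, hzu.ne'])
      (by have := degOn_le_card (G := G) {z, y} u; rw [card_pair hzy] at *; lia)
    have hsub3 : ({u, z, y} : Finset V) ⊆ B := by
      intro v hv
      simp only [mem_insert, mem_singleton] at hv
      rcases hv with rfl | rfl | rfl <;> assumption
    have hg2 : Grow G {u, z, y} B := by
      have := Grow.sdiff (G := G) (A := B) (B \ {u, z, y}) sdiff_subset (by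
        intro w hw
        simp only [mem_sdiff, mem_insert, mem_singleton, not_or] at hw
        exact hleaf w hw.1 hw.2.2.2 hw.2.2.1 fun h =>
          hw.2.1 (degOn_le_one_iff.1 hdz w hw.1 u hu h.symm hzu))
      rwa [Finset.sdiff_sdiff_eq_self hsub3] at this
    have hg3 := hg2.trans hg
    have h3 : ({u, z, y} : Finset V).card = 3 := by
      rw [card_insert_of_notMem (by simp [huy, hzu.ne']), card_pair hzy]
    obtain ⟨g₂, e2, c2, i2⟩ := c1.extend_grow hk Subset.rfl i1 hg3 (by
      rw [card_sdiff_of_subset hg3.subset]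
      have := card_le_card hg3.subset
      lia)
    rw [union_sdiff_of_subset hg3.subset] at i2
    have ey : g₂ y = g y := by rw [e2 (by simp), e1 (by simp)]
    have ez : g₂ z = g z := by rw [e2 (by simp), e1 (by simp)]
    obtain ⟨g₃, -, c3, i3⟩ := c2.extend_last hk Subset.rfl i2 (notMem_erase x U) hyx
      (hg.subset hzB) (fun v hv => hxy' v (mem_of_mem_erase hv)) (by rw [ey, ez]; exact hsl)
      (by lia)
    rw [insert_erase hx] at c3 i3
    exact .of_injOn (by lia) hU c3 i3

end Block

/-! ### Choosing the vertices of a block. -/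

section Selection

variable {V : Type u} {G : SimpleGraph V}

theorem StarAt.card_le_degOn {U : Finset V} {c : V} (h : StarAt G U c) :
    U.card ≤ degOn G U c + 1 := by
  classical
  have : U.erase c ⊆ U.filter (G.Adj c) := fun v hv =>
    mem_filter.2 ⟨mem_of_mem_erase hv, h v (mem_of_mem_erase hv) (ne_of_mem_erase hv)⟩
  have h1 := card_le_card this
  have h2 := pred_card_le_card_erase (s := U) (a := c)
  have h3 : degOn G U c = (U.filter (G.Adj c)).card := rfl
  lia

/-- A forest has a vertex `x` of degree at most one, attached to a vertex `y` that has at most one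
neighbor of degree at least two. -/
theorem exists_leaf_pair (hG : G.IsAcyclic) {U : Finset V} (hU : 2 ≤ U.card) :
    ∃ x ∈ U, ∃ y ∈ U, x ≠ y ∧ (∀ v ∈ U, G.Adj x v → v = y) ∧
      (∀ a ∈ U, ∀ b ∈ U, G.Adj y a → G.Adj y b → 2 ≤ degOn G U a → 2 ≤ degOn G U b → a = b) ∧
      (G.Adj y x ∨ degOn G U y ≤ 1) := by
  classical
  set I := U.filter fun v => 2 ≤ degOn G U v with hI
  rcases I.eq_empty_or_nonempty with hIe | ⟨p, hp⟩
  · have hd : ∀ v ∈ U, degOn G U v ≤ 1 := by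
      intro v hv
      by_contra h
      have : v ∈ I := mem_filter.2 ⟨hv, by lia⟩
      simp [hIe] at this
    obtain ⟨x, hx⟩ : U.Nonempty := card_pos.1 (by lia)
    have h2 : ∀ a ∈ U, ¬ 2 ≤ degOn G U a := fun a ha h => by have := hd a ha; lia
    by_cases hn : ∃ y ∈ U, G.Adj x y
    · obtain ⟨y, hy, hxy⟩ := hn
      exact ⟨x, hx, y, hy, hxy.ne,
        fun v hv h => degOn_le_one_iff.1 (hd x hx) v hv y hy h hxy,
        fun a ha _ _ _ _ h => absurd h (h2 a ha), .inl hxy.symm⟩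
    · push Not at hn
      obtain ⟨y, hy, hyx⟩ := exists_mem_ne (by lia : 1 < U.card) x
      exact ⟨x, hx, y, hy, hyx.symm, fun v hv h => absurd h (hn v hv),
        fun a ha _ _ _ _ h => absurd h (h2 a ha), .inr (hd y hy)⟩
  -- A vertex `y` with at most one neighbor in `I` has at least two in `U`; one outside `I` serves
  -- as `x`.
  · obtain ⟨y, hyI, hdy⟩ : ∃ y ∈ I, degOn G I y ≤ 1 := by
      by_cases hc : 2 ≤ I.card
      · obtain ⟨y, hy, -, h⟩ := exists_degOn_le_one hG hc p
        exact ⟨y, hy, h⟩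
      · exact ⟨p, hp, (degOn_le_card _ _).trans (by lia)⟩
    have hy := mem_filter.1 hyI
    obtain ⟨x, hx, hxI⟩ : ∃ x ∈ U.filter (G.Adj y), x ∉ I.filter (G.Adj y) :=
      exists_mem_notMem_of_card_lt_card (hdy.trans_lt hy.2)
    have hx' := mem_filter.1 hx
    have hdx : degOn G U x ≤ 1 := by
      by_contra h
      exact hxI (mem_filter.2 ⟨mem_filter.2 ⟨hx'.1, by lia⟩, hx'.2⟩)
    exact ⟨x, hx'.1, y, hy.1, hx'.2.ne',
      fun v hv h => degOn_le_one_iff.1 hdx v hv y hy.1 h hx'.2.symm,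
      fun a ha b hb h1 h2 h3 h4 => degOn_le_one_iff.1 hdy a (mem_filter.2 ⟨ha, h3⟩) b
        (mem_filter.2 ⟨hb, h4⟩) h1 h2, .inl hx'.2⟩

/-- Removing `k - 3` vertices, preferably neighbors of `y`, so that `y` has at most two neighbors
left. -/
theorem exists_grow_degOn_le_two [DecidableEq V] (hG : G.IsAcyclic) {k : ℕ} (hk : 4 ≤ k)
    {U : Finset V} {x y : V} (hU : k < U.card) (hx : x ∈ U) (hy : y ∈ U) (hxy : x ≠ y)
    (hd : degOn G U y ≤ k)
    (hy1 : ∀ a ∈ U, ∀ b ∈ U, G.Adj y a → G.Adj y b → 2 ≤ degOn G U a → 2 ≤ degOn G U b → a = b)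
    (hyx : G.Adj y x ∨ degOn G U y ≤ 1) :
    ∃ B, Grow G B (U.erase x) ∧ y ∈ B ∧ (U.erase x \ B).card + 3 = k ∧ degOn G B y ≤ 2 ∧
      (degOn G B y ≤ 1 ∨ ∀ v ∈ U.erase x \ B, G.Adj y v) := by
  classical
  have hyA : y ∈ U.erase x := mem_erase.2 ⟨hxy.symm, hy⟩
  have hAc := card_erase_add_one hx
  have hdA : degOn G (U.erase x) y + 1 ≤ k := by
    rcases hyx with h | h
    · rwa [degOn_erase_of_adj hx h]
    · have := degOn_mono (G := G) (erase_subset x U) y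
      lia
  set D := (U.erase x).filter fun v => G.Adj y v ∧ degOn G U v ≤ 1 with hD
  have hDA : D ⊆ U.erase x := filter_subset _ _
  have hyD : y ∉ D := fun h => G.irrefl (mem_filter.1 h).2.1
  have hgrow : ∀ T ⊆ D, Grow G (U.erase x \ T) (U.erase x) := fun T hT =>
    Grow.sdiff T (hT.trans hDA) fun w hw =>
      (degOn_mono (erase_subset _ _) w).trans (mem_filter.1 (hT hw)).2.2
  by_cases hDk : k - 3 ≤ D.card
  · obtain ⟨T, hT, hTc⟩ := exists_subset_card_eq hDk
    refine ⟨U.erase x \ T, hgrow T hT, mem_sdiff.2 ⟨hyA, fun h => hyD (hT h)⟩, ?_, ?_, .inr ?_⟩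
    · rw [Finset.sdiff_sdiff_eq_self (hT.trans hDA)]
      lia
    · have e : (U.erase x \ T).filter (G.Adj y) = (U.erase x).filter (G.Adj y) \ T := by
        ext v
        simp only [mem_filter, mem_sdiff]
        tauto
      have h1 : T ⊆ (U.erase x).filter (G.Adj y) := fun v hv =>
        mem_filter.2 ⟨hDA (hT hv), (mem_filter.1 (hT hv)).2.1⟩
      have h2 : degOn G (U.erase x \ T) y = degOn G (U.erase x) y - T.card := by
        unfold degOn
        rw [← card_sdiff_of_subset h1, ← e]
      lia
    · rw [Finset.sdiff_sdiff_eq_self (hT.trans hDA)]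
      exact fun v hv => (mem_filter.1 (hT hv)).2.1
  · have hc := card_sdiff_of_subset hDA
    obtain ⟨B, hB, hyB, hBc, hg⟩ := exists_grow hG (U.erase x \ D) (mem_sdiff.2 ⟨hyA, hyD⟩)
      (m := U.card + 2 - k) (by lia) (by lia)
    have hg' := hg.trans (hgrow D Subset.rfl)
    have hdB : degOn G B y ≤ 1 := by
      refine degOn_le_one_iff.2 fun a ha b hb h1 h2 => ?_
      have h3 : ∀ a ∈ B, G.Adj y a → a ∈ U ∧ 2 ≤ degOn G U a := by
        intro a ha h1
        have ha' := mem_sdiff.1 (hB ha)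
        refine ⟨mem_of_mem_erase ha'.1, ?_⟩
        by_contra hlt
        exact ha'.2 (mem_filter.2 ⟨ha'.1, h1, by lia⟩)
      exact hy1 a (h3 a ha h1).1 b (h3 b hb h2).1 h1 h2 (h3 a ha h1).2 (h3 b hb h2).2
    refine ⟨B, hg', hyB, ?_, by lia, .inl hdB⟩
    rw [card_sdiff_of_subset hg'.subset]
    lia

/-- In a forest on `2k` vertices with a vertex `c` of degree `k`, if some other leaf `x` is not
attached to a neighbor of `c`, then `c` is attached to two leaves. -/
theorem exists_two_leaves (hG : G.IsAcyclic) {k : ℕ} {U : Finset V} {c x : V}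
    (hU : U.card = 2 * k) (hc : c ∈ U) (hd : degOn G U c = k) (hx : x ∈ U) (hxc : x ≠ c)
    (hcx : ¬ G.Adj c x) (hx' : ∀ v ∈ U, G.Adj c v → ¬ G.Adj x v) :
    ∃ a ∈ U, ∃ b ∈ U, a ≠ b ∧ G.Adj c a ∧ G.Adj c b ∧ degOn G U a ≤ 1 ∧ degOn G U b ≤ 1 := by
  classical
  set N := U.filter (G.Adj c) with hN
  have hNc : N.card = k := hd
  set Q := ((U \ N).erase c).erase x with hQ
  have hQc : Q.card + 2 = k := by
    have h1 : c ∈ U \ N := by simp [hN, hc]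
    have h2 : x ∈ (U \ N).erase c := by simp [hN, hx, hxc, hcx]
    have h3 := card_erase_add_one h1
    have h4 := card_erase_add_one h2
    rw [card_sdiff_of_subset (filter_subset _ _)] at h3
    lia
  -- A neighbor of `c` that is not a leaf has a second neighbor. It lies in `Q`, as there are no
  -- triangles, and different neighbors of `c` get different ones, as there are no 4-cycles. So at
  -- most `k - 2` of the `k` neighbors are not leaves.
  have hex : ∀ v ∈ N.filter (fun v => ¬ degOn G U v ≤ 1), ∃ q ∈ Q, G.Adj v q := by
    intro v hv
    obtain ⟨hvN, hvd⟩ := mem_filter.1 hv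
    obtain ⟨hvU, hcv⟩ := mem_filter.1 hvN
    obtain ⟨q, hq, hqc⟩ := exists_mem_ne (by unfold degOn at hvd; lia :
      1 < (U.filter (G.Adj v)).card) c
    obtain ⟨hqU, hvq⟩ := mem_filter.1 hq
    refine ⟨q, ?_, hvq⟩
    have h1 : q ≠ x := by
      rintro rfl
      exact hx' v hvU hcv hvq.symm
    have h2 : ¬ G.Adj c q := fun h => not_adj_of_isAcyclic hG hcv h hvq
    simp [hQ, hN, h1, h2, hqc, hqU]
  have : Nonempty V := ⟨c⟩
  choose! g hgQ hg using hex
  have hle : (N.filter (fun v => ¬ degOn G U v ≤ 1)).card ≤ Q.card := by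
    refine card_le_card_of_injOn g (fun v hv => hgQ v hv) fun v hv v' hv' h => ?_
    have h1 := hg v hv
    have h2 := hg v' hv'
    rw [← h] at h2
    have hne : c ≠ g v := by
      have := hgQ v hv
      simp only [hQ, mem_erase] at this
      exact this.2.1.symm
    exact eq_of_isAcyclic hG hne (mem_filter.1 (mem_filter.1 hv).1).2 h1
      (mem_filter.1 (mem_filter.1 hv').1).2 h2
  have hsum := card_filter_add_card_filter_not (s := N) (fun v => degOn G U v ≤ 1)
  obtain ⟨a, ha, b, hb, hab⟩ := one_lt_card.1
    (by lia : 1 < (N.filter fun v => degOn G U v ≤ 1).card)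
  obtain ⟨haN, had⟩ := mem_filter.1 ha
  obtain ⟨hbN, hbd⟩ := mem_filter.1 hb
  obtain ⟨haU, hca⟩ := mem_filter.1 haN
  obtain ⟨hbU, hcb⟩ := mem_filter.1 hbN
  exact ⟨a, haU, b, hbU, hab, hca, hcb, had, hbd⟩

end Selection

/-! ### The induction, and the passage to the whole vertex set. -/

section Main

variable {V : Type u} {Γ : Type w} {G : SimpleGraph V} {H : Cover G Γ} {k : ℕ}

/-- The alternative in `hs` is needed because the induction may reach a star on fewer than `k`
vertices, which is harmless. -/
theorem Cover.colorableOn (hG : G.IsAcyclic) (hk : H.IsKCover k) (hk4 : 4 ≤ k) (U : Finset V)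
    (hdeg : ∀ v ∈ U, degOn G U v ≤ k) (hs : U.card < k ∨ ∀ c ∈ U, ¬ StarAt G U c) :
    H.ColorableOn U k := by
  classical
  induction U using Finset.strongInduction with
  | H U ih =>
  rcases lt_trichotomy U.card k with hUk | hUk | hUk
  · exact Cover.colorableOn_of_card_lt hG hk hUk
  · exact Cover.colorableOn_of_card_eq hG hk hk4 hUk (hs.resolve_left hUk.not_lt)
  have hs := hs.resolve_left hUk.not_gt
  have block : ∀ {B : Finset V} {x y z : V}, x ∈ U → Grow G B (U.erase x) →
      (U.erase x \ B).card + 3 = k → y ∈ B → z ∈ B → y ≠ z → ¬ G.Adj y z →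
      (∀ v ∈ U, G.Adj x v → v = y) → degOn G B y + degOn G B z < k → degOn G B z ≤ 1 →
      (((B.erase y).erase z).card < k ∨
        ∀ c ∈ (B.erase y).erase z, ¬ StarAt G ((B.erase y).erase z) c) → H.ColorableOn U k := by
    intro B x y z hx hg hB hy hz hyz hadj hxy hd hdz hR
    refine .of_block hk hk4 hx hg hB hy hz hyz hadj hxy hd (by lia) (ih _ ?_ ?_ hR)
    · exact ((erase_subset _ _).trans (erase_subset _ _)).trans_ssubset
        (hg.subset.trans_ssubset (erase_ssubset hx))
    · have hsub : (B.erase y).erase z ⊆ U := ((erase_subset _ _).trans (erase_subset _ _)).trans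
        (hg.subset.trans (erase_subset _ _))
      exact fun v hv => (degOn_mono hsub v).trans (hdeg v (hsub hv))
  obtain ⟨x, hx, y, hy, hxy, hxN, hyN, hyx⟩ := exists_leaf_pair hG (U := U) (by lia)
  obtain ⟨B, hg, hyB, hBc, hdy, hdy'⟩ :=
    exists_grow_degOn_le_two hG hk4 hUk hx hy hxy (hdeg y hy) hyN hyx
  have hBU : B ⊆ U := hg.subset.trans (erase_subset _ _)
  have hBcard : B.card + k = U.card + 2 := by
    have h1 := card_erase_add_one hx
    have h2 := card_sdiff_add_card_eq_card hg.subset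
    lia
  -- As `|B| ≥ 3`, a star at `y` would give `y` degree at least two in `B`; then all deleted
  -- vertices are neighbors of `y`, and `U` itself is a star.
  have hBs : ¬ StarAt G B y := by
    intro h
    have h1 := h.card_le_degOn
    refine hs y hy fun v hv hvy => ?_
    by_cases hvx : v = x
    · subst hvx
      refine hyx.resolve_right fun h2 => ?_
      have := degOn_mono (G := G) hBU y
      lia
    · by_cases hvB : v ∈ B
      · exact h v hvB hvy
      · exact (hdy'.resolve_left (by lia)) v (mem_sdiff.2 ⟨mem_erase.2 ⟨hvx, hv⟩, hvB⟩)
  obtain ⟨z, hzB, hzy, hyz, hdz⟩ := exists_not_adj_degOn_le_one hG B hyB hBs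
  set R := (B.erase y).erase z with hR
  by_cases hRs : R.card < k ∨ ∀ c ∈ R, ¬ StarAt G R c
  · exact block hx hg hBc hyB hzB hzy.symm hyz hxN (by lia) hdz hRs
  push Not at hRs
  obtain ⟨hRk, c, hcR, hcs⟩ := hRs
  have hRB : R ⊆ B := (erase_subset _ _).trans (erase_subset _ _)
  have hRcard : R.card + 2 = B.card := by
    have h1 := card_erase_add_one hyB
    have h2 := card_erase_add_one (mem_erase.2 ⟨hzy, hzB⟩)
    lia
  have hcB := hRB hcR
  have hcU := hBU hcB
  have hcy : c ≠ y := fun h => by simp [hR, h] at hcR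
  have hcz : c ≠ z := fun h => by simp [hR, h] at hcR
  have hmemR : ∀ v ∈ B, v ≠ y → v ≠ z → v ∈ R := fun v hv h1 h2 =>
    mem_erase.2 ⟨h2, mem_erase.2 ⟨h1, hv⟩⟩
  by_cases hzc : G.Adj c z
  swap
  -- Having no 4-cycles, `y` and `z` are each adjacent to at most one of the at least three leaves
  -- of the star, so some leaf `l` can replace `z`. Afterwards `c` and `z` are nonadjacent, so
  -- neither is a center, and any other center closes a triangle with `c`.
  · have hone : ∀ v, v ≠ c → degOn G (R.erase c) v ≤ 1 := by
      intro v hvc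
      refine degOn_le_one_iff.2 fun a ha b hb h1 h2 => ?_
      rw [mem_erase] at ha hb
      exact eq_of_isAcyclic hG hvc h1 (hcs a ha.2 ha.1).symm h2 (hcs b hb.2 hb.1).symm
    obtain ⟨l, hl, hyl, hzl⟩ : ∃ l ∈ R.erase c, ¬ G.Adj y l ∧ ¬ G.Adj z l := by
      by_contra! hcon
      have hsub : R.erase c ⊆ (R.erase c).filter (G.Adj y) ∪ (R.erase c).filter (G.Adj z) := by
        intro v hv
        by_cases h : G.Adj y v
        · exact mem_union_left _ (mem_filter.2 ⟨hv, h⟩)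
        · exact mem_union_right _ (mem_filter.2 ⟨hv, hcon v hv h⟩)
      have h1 := (card_le_card hsub).trans (card_union_le _ _)
      have h2 : ((R.erase c).filter (G.Adj y)).card ≤ 1 := hone y hcy.symm
      have h3 : ((R.erase c).filter (G.Adj z)).card ≤ 1 := hone z hcz.symm
      have h4 := card_erase_add_one hcR
      lia
    obtain ⟨hlc, hlR⟩ := mem_erase.1 hl
    have hlB := hRB hlR
    have hly : l ≠ y := fun h => by simp [hR, h] at hlR
    have hlz : l ≠ z := fun h => by simp [hR, h] at hlR
    have hdl : degOn G B l ≤ 1 := by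
      have : ∀ a ∈ B, G.Adj l a → a = c := by
        intro a ha hla
        by_contra hac
        have hay : a ≠ y := by rintro rfl; exact hyl hla.symm
        have haz : a ≠ z := by rintro rfl; exact hzl hla.symm
        exact not_adj_of_isAcyclic hG (hcs l hlR hlc) (hcs a (hmemR a ha hay haz) hac) hla
      exact degOn_le_one_iff.2 fun a ha b hb h1 h2 => (this a ha h1).trans (this b hb h2).symm
    refine block hx hg hBc hyB hlB hly.symm hyl hxN (by lia) hdl (.inr fun e he hes => ?_)
    have hmem : ∀ v ∈ B, v ≠ y → v ≠ l → v ∈ (B.erase y).erase l := fun v hv h1 h2 =>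
      mem_erase.2 ⟨h2, mem_erase.2 ⟨h1, hv⟩⟩
    simp only [mem_erase] at he
    obtain ⟨hel, hey, heB⟩ := he
    by_cases hec : e = c
    · subst hec
      exact hzc (hes z (hmem z hzB hzy hlz.symm) hcz.symm)
    by_cases hez : e = z
    · subst hez
      exact hzc (hes c (hmem c hcB hcy hlc.symm) hcz).symm
    obtain ⟨t, ht, ht'⟩ : ∃ t ∈ R, t ∉ ({c, l, e} : Finset V) :=
      exists_mem_notMem_of_card_lt_card (by
        have := card_le_three (a := c) (b := l) (c := e); lia)
    simp only [mem_insert, mem_singleton, not_or] at ht'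
    have hty : t ≠ y := fun h => by simp [hR, h] at ht
    exact not_adj_of_isAcyclic hG (hcs e (hmemR e heB hey hez) hec) (hcs t ht ht'.1)
      (hes t (hmem t (hRB ht) hty ht'.2.1) ht'.2.2)
  -- Now `c` has at least `|R| ≥ k` neighbors, hence exactly `k`, which forces `|U| = 2k`. The new
  -- block has `c` for `y`, one leaf `a` at `c` for `x`, and another leaf `b` among the deleted
  -- vertices.
  · have hzR : z ∉ R := by simp [hR]
    have hNsub : insert z (R.erase c) ⊆ U.filter (G.Adj c) := by
      intro v hv
      rcases mem_insert.1 hv with rfl | hv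
      · exact mem_filter.2 ⟨hBU hzB, hzc⟩
      · rw [mem_erase] at hv
        exact mem_filter.2 ⟨hBU (hRB hv.2), hcs v hv.2 hv.1⟩
    have hNc : (insert z (R.erase c)).card = R.card := by
      rw [card_insert_of_notMem fun h => hzR (mem_of_mem_erase h), card_erase_add_one hcR]
    have hdc : (U.filter (G.Adj c)).card ≤ k := hdeg c hcU
    have hNeq := eq_of_subset_of_card_le hNsub (by lia)
    have hRk' : R.card = k := le_antisymm (by rw [← hNc, hNeq]; exact hdc) hRk
    have hU2 : U.card = 2 * k := by lia
    have hNdeg : degOn G U c = k := by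
      rw [← hRk', ← hNc, hNeq]
      rfl
    have hNB : ∀ v ∈ U, G.Adj c v → v ∈ B ∧ v ≠ y := by
      intro v hv hcv
      have : v ∈ insert z (R.erase c) := hNeq ▸ mem_filter.2 ⟨hv, hcv⟩
      rcases mem_insert.1 this with rfl | hv'
      · exact ⟨hzB, hzy⟩
      · have := mem_of_mem_erase hv'
        refine ⟨hRB this, fun h => ?_⟩
        simp [hR, h] at this
    have hxB : x ∉ B := fun h => notMem_erase x U (hg.subset h)
    obtain ⟨a, ha, b, hb, hab, hca, hcb, hda, hdb⟩ := exists_two_leaves hG hU2 hcU hNdeg hx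
      (by rintro rfl; exact hxB hcB) (fun h => hxB (hNB x hx h).1)
      (fun v hv hcv h => (hNB v hv hcv).2 (hxN v hv h))
    have hbA : b ∈ U.erase a := mem_erase.2 ⟨hab.symm, hb⟩
    have hcA : c ∈ (U.erase a).erase b := mem_erase.2 ⟨hcb.ne, mem_erase.2 ⟨hca.ne, hcU⟩⟩
    have hA1 := card_erase_add_one ha
    have hA2 := card_erase_add_one hbA
    -- Of these `k + 2` vertices, `c` and the new `z` go to the block and `k` remain. Without `a`
    -- and `b`, the degree of `c` is at most `k - 2`, as the joint coloring requires.
    obtain ⟨B', hB', hcB', hB'c, hg'⟩ := exists_grow hG _ hcA (m := k + 2) (by lia) (by lia)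
    have hg'' := hg'.trans (.of_erase hbA ((degOn_mono (erase_subset _ _) b).trans hdb))
    have hdc' : degOn G B' c + 2 ≤ k := by
      have h1 := degOn_mono (G := G) hB' c
      have h2 := degOn_erase_of_adj hbA hcb
      have h3 := degOn_erase_of_adj ha hca
      lia
    obtain ⟨e, heB, hec, hce, hde⟩ := exists_not_adj_degOn_le_one hG B' hcB' (fun h => by
      have := h.card_le_degOn
      lia)
    refine block ha hg'' ?_ hcB' heB hec.symm hce
      (fun v hv h => degOn_le_one_iff.1 hda v hv c hcU h hca.symm) (by lia) hde
      (.inr fun d hd hds => ?_)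
    · have := card_sdiff_add_card_eq_card hg''.subset
      lia
    set R' := (B'.erase c).erase e with hR'
    have hR'U : R' ⊆ U := (((erase_subset _ _).trans (erase_subset _ _)).trans hg''.subset).trans
      (erase_subset _ _)
    have hR'c : R'.card = k := by
      have h1 := card_erase_add_one hcB'
      have h2 := card_erase_add_one (mem_erase.2 ⟨hec, heB⟩)
      lia
    have heU : e ∈ U := mem_of_mem_erase (hg''.subset heB)
    -- Outside `R'` lie `k` vertices, among them `c` and its non-neighbor `e`, so at least two of
    -- the `k` neighbors of `c` are in `R'`. With them a star center in `R'` closes a triangle or a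
    -- 4-cycle.
    obtain ⟨s, hs1, t, ht1, hst⟩ : ∃ s ∈ R'.filter (G.Adj c), ∃ t ∈ R'.filter (G.Adj c), s ≠ t := by
      rw [← one_lt_card]
      have hsub : U.filter (G.Adj c) ⊆ R'.filter (G.Adj c) ∪ ((U \ R').erase c).erase e := by
        intro v hv
        obtain ⟨hvU, hcv⟩ := mem_filter.1 hv
        by_cases hvR : v ∈ R'
        · exact mem_union_left _ (mem_filter.2 ⟨hvR, hcv⟩)
        · refine mem_union_right _ (mem_erase.2 ⟨?_, mem_erase.2 ⟨hcv.ne', mem_sdiff.2 ⟨hvU, hvR⟩⟩⟩)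
          rintro rfl
          exact hce hcv
      have h1 := (card_le_card hsub).trans (card_union_le _ _)
      have h2 : (U.filter (G.Adj c)).card = k := hNdeg
      have hc1 : c ∈ U \ R' := by simp [hR', hcU]
      have he1 : e ∈ (U \ R').erase c := by simp [hR', heU, hec]
      have h3 := card_erase_add_one hc1
      have h4 := card_erase_add_one he1
      rw [card_sdiff_of_subset hR'U] at h3
      lia
    obtain ⟨hsR, hcs'⟩ := mem_filter.1 hs1
    obtain ⟨htR, hct⟩ := mem_filter.1 ht1
    have hcR' : c ∉ R' := by simp [hR']
    by_cases hds' : d = s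
    · subst hds'
      exact not_adj_of_isAcyclic hG hcs' hct (hds t htR hst.symm)
    by_cases hdt : d = t
    · subst hdt
      exact not_adj_of_isAcyclic hG hct hcs' (hds s hsR hst)
    exact hst (eq_of_isAcyclic hG (by rintro rfl; exact hcR' hd) hcs' (hds s hsR (Ne.symm hds')).symm
      hct (hds t htR (Ne.symm hdt)).symm)

theorem Cover.isColoring_of_isColoringOn_univ [Fintype V] {f : V → Γ}
    (h : H.IsColoringOn univ f) : H.IsColoring f := by
  refine ⟨fun v => h.1 v (mem_univ v), ?_⟩
  rintro _ ⟨u, rfl⟩ _ ⟨v, rfl⟩ -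
  exact h.2 u (mem_univ u) v (mem_univ v)

/-- If `k` divides `|V|`, no class is large, so the bound drops to the floor; otherwise floor plus
one is the ceiling. -/
theorem isStronglyBounded_of_univ [Fintype V] (hk : 0 < k) {f : V → Γ}
    (h : StronglyBoundedOn univ f k) : IsStronglyBounded f k := by
  classical
  have hc : ∀ α, classSize f α = (univ.filter fun v => f v = α).card := by
    intro α
    rw [classSize, ← Set.ncard_coe_finset]
    congr 1
    ext v
    simp
  have hn : Nat.card V = (univ : Finset V).card := by simp
  have hlarge : {α | classSize f α = Nat.card V / k + 1}.encard ≤ (Nat.card V % k : ℕ) := by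
    have : {α | classSize f α = Nat.card V / k + 1} = (((univ.image f).filter fun α =>
        (univ.filter fun v => f v = α).card = (univ : Finset V).card / k + 1 : Finset Γ) :
          Set Γ) := by
      ext α
      rw [Set.mem_ofPred_eq, mem_coe, mem_filter, hc, hn]
      refine ⟨fun h => ⟨?_, h⟩, fun h => h.2⟩
      obtain ⟨v, hv⟩ := card_pos.1 (by lia : 0 < (univ.filter fun v => f v = α).card)
      exact mem_image.2 ⟨v, (mem_filter.1 hv).1, (mem_filter.1 hv).2⟩
    rw [this, Set.encard_coe_eq_coe_finsetCard, hn]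
    exact_mod_cast h.2
  refine ⟨fun α => ?_, hlarge⟩
  have h1 := h.1 α
  rw [← hc, ← hn] at h1
  rw [Nat.ceilDiv_eq_add_pred_div]
  rcases Nat.eq_zero_or_pos (Nat.card V % k) with h0 | h0
  · have hne : classSize f α ≠ Nat.card V / k + 1 := by
      intro hα
      rw [h0, Nat.cast_zero, nonpos_iff_eq_zero, Set.encard_eq_zero] at hlarge
      exact Set.notMem_empty α (hlarge ▸ hα)
    have : Nat.card V / k ≤ (Nat.card V + k - 1) / k := Nat.div_le_div_right (by lia)
    lia
  · refine h1.trans ?_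
    rw [Nat.le_div_iff_mul_le hk]
    have := Nat.div_add_mod (Nat.card V) k
    rw [add_mul, one_mul, mul_comm]
    lia

end Main

end EquitableDP

theorem theorem4p3 {V : Type u} [Fintype V] (G : SimpleGraph V) [DecidableRel G.Adj]
    (hG : G.IsAcyclic) :
    EquitableDP.IsStar G ∨
      ∀ k : ℕ, max G.maxDegree 4 ≤ k → EquitableDP.IsSEDPColorable.{u, w} G k := by
  by_cases hs : EquitableDP.IsStar G
  · exact .inl hs
  refine .inr fun k hk Γ H hH => ?_
  have hk4 : 4 ≤ k := (le_max_right _ _).trans hk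
  obtain ⟨f, hf, hfs⟩ := EquitableDP.Cover.colorableOn hG hH hk4 Finset.univ (fun v _ => by
    refine le_trans (le_of_eq ?_) ((G.degree_le_maxDegree v).trans ((le_max_left _ _).trans hk))
    rw [EquitableDP.degOn, ← SimpleGraph.card_neighborFinset_eq_degree]
    congr 1
    ext w
    simp) (.inr fun c _ hc => hs ⟨c, by
      ext a b
      rw [SimpleGraph.starGraph_adj]
      refine ⟨fun h => ⟨h.ne, ?_⟩, ?_⟩
      · by_contra! hab
        exact EquitableDP.not_adj_of_isAcyclic hG (hc a (Finset.mem_univ a) hab.1)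
          (hc b (Finset.mem_univ b) hab.2) h
      · rintro ⟨hne, rfl | rfl⟩
        · exact hc b (Finset.mem_univ b) hne.symm
        · exact (hc a (Finset.mem_univ a) hne).symm⟩)
  exact ⟨f, EquitableDP.Cover.isColoring_of_isColoringOn_univ hf,
    EquitableDP.isStronglyBounded_of_univ (by lia) hfs⟩
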